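/- Manifolds are smooth, finite-dimensional, Hausdorff and second countable (not necessarily connected). A subset $L$ of a manifold $M$ is a \emph{weakly-embedded submanifold} if it carries a manifold structure for which the inclusion $L\hookrightarrow M$ is an immersion and for which a map from an open subset of a Cartesian space $\mathbb{R}^d$ to $L$ is smooth if and only if it is smooth as a map to $M$. A \emph{singular foliation} of $M$ is a partition $\mathcal{F}$ of $M$ into connected weakly-embedded submanifolds, called leaves, such that about each $x\in M$ there is a chart $\psi: V\to U\times W$ of $M$, where $U\subseteq\mathbb{R}^k$ and $W\subseteq\mathbb{R}^{\dim M-k}$ are open neighbourhoods of the origins and $k$ is the dimension of the leaf through $x$, with $\psi(x)=(0,0)$ and such that for each leaf $L$ we have $\psi(L\cap V)=U\times\ell$ for some $\ell\subseteq W$. Write $T\mathcal{F}=\bigcup_{x\in M}T_xL_x\subseteq TM$, where $L_x$ is the leaf through $x$. For a surjective submersion $p:M\to N$ with connected fibers and a singular foliation $\mathcal{G}$ of $N$, the pullback $p^{-1}\mathcal{G}$ is the singular foliation of $M$ with $T(p^{-1}\mathcal{G})=(dp)^{-1}(T\mathcal{G})$, whose leaves are the sets $p^{-1}(L)$, for $L$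 a leaf of $\mathcal{G}$. Two singular foliations $(N_0,\mathcal{F}_0)$ and $(N_1,\mathcal{F}_1)$ are \emph{Molino transverse equivalent} if there are a manifold $M$ with a singular foliation $\mathcal{F}$ and surjective submersions with connected fibers $p_i:M\to N_i$ such that $p_i^{-1}(\mathcal{F}_i)=\mathcal{F}$ for $i=0,1$. \textbf{Proposition.} Molino transverse equivalence is an equivalence relation on singular foliations: it is reflexive, symmetric and transitive. -/

import Mathlib

open scoped Manifold ContDiff

universe u

namespace SingularFol

/-- A smooth manifold: finite-dimensional, without boundary, Hausdorff and second countable.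
It need not be connected and may be empty. -/
structure SmoothMfd : Type (u + 1) where
  /-- The underlying set. -/
  carrier : Type u
  /-- The dimension. -/
  dim : ℕ
  [topologicalSpace : TopologicalSpace carrier]
  [chartedSpace : ChartedSpace (EuclideanSpace ℝ (Fin dim)) carrier]
  [isManifold : IsManifold (𝓡 dim) ∞ carrier]
  [t2Space : T2Space carrier]
  [secondCountable : SecondCountableTopology carrier]

namespace SmoothMfd

instance : CoeSort SmoothMfd.{u} (Type u) := ⟨carrier⟩

attribute [instance] topologicalSpace chartedSpace isManifold t2Space secondCountable

end SmoothMfd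

/-- `ι : X → M` exhibits the subset `L` of `M` as a weakly-embedded submanifold: `ι` is an
injective immersion with image `L` and, after the identification of `X` with `L` through `ι`, the
plots of the manifold `X` (the smooth maps into `X` from open subsets of Cartesian spaces) are
exactly the plots of the subspace diffeology of `L` (the smooth maps into `M` from such subsets,
with values in `L`). -/
structure IsWeakEmbeddingOnto {X M : SmoothMfd.{u}} (ι : X → M) (L : Set M) : Prop where
  range_eq : Set.range ι = L
  injective : Function.Injective ι
  isImmersion : Manifold.IsImmersion (𝓡 X.dim) (𝓡 M.dim) ∞ ι
  plots : ∀ (d : ℕ) (U : Set (EuclideanSpace ℝ (Fin d))), IsOpen U →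
    ∀ f : EuclideanSpace ℝ (Fin d) → X,
      ContMDiffOn (𝓡 d) (𝓡 X.dim) ∞ f U ↔ ContMDiffOn (𝓡 d) (𝓡 M.dim) ∞ (ι ∘ f) U

/-- `L` is a weakly-embedded submanifold of `M` of dimension `k`, connected in its manifold
topology. -/
def IsConnectedWeaklyEmbedded {M : SmoothMfd.{u}} (L : Set M) (k : ℕ) : Prop :=
  ∃ (X : SmoothMfd.{u}) (ι : X → M),
    X.dim = k ∧ ConnectedSpace X ∧ IsWeakEmbeddingOnto ι L

/-- About the point `x` there is a chart of `M`, a diffeomorphism `ψ` from an open set onto a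
product `U × W` of open neighbourhoods of the origins of `ℝᵏ` and `ℝˡ`, `k + l = dim M`, which
sends `x` to `(0, 0)` and in which every member of `leaves` has the form `U × ℓ`. -/
def HasAdaptedChart {M : SmoothMfd.{u}} (leaves : Set (Set M)) (k : ℕ) (x : M) : Prop :=
  ∃ (l : ℕ) (_ : k + l = M.dim)
    (ψ : OpenPartialHomeomorph M (EuclideanSpace ℝ (Fin k) × EuclideanSpace ℝ (Fin l)))
    (U : Set (EuclideanSpace ℝ (Fin k))) (W : Set (EuclideanSpace ℝ (Fin l))),
    ContMDiffOn (𝓡 M.dim) 𝓘(ℝ, EuclideanSpace ℝ (Fin k) × EuclideanSpace ℝ (Fin l)) ∞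
      ψ ψ.source ∧
    ContMDiffOn 𝓘(ℝ, EuclideanSpace ℝ (Fin k) × EuclideanSpace ℝ (Fin l)) (𝓡 M.dim) ∞
      ψ.symm ψ.target ∧
    IsOpen U ∧ IsOpen W ∧ ψ.target = U ×ˢ W ∧
    x ∈ ψ.source ∧ ψ x = (0, 0) ∧
    ∀ L ∈ leaves, ∃ ℓ ⊆ W, ψ '' (L ∩ ψ.source) = U ×ˢ ℓ

/-- A (Stefan) singular foliation of `M`: a partition of `M` into connected, weakly-embedded
submanifolds, such that about each point there is an adapted chart, whose first factor has the
dimension of the leaf through that point. -/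
structure SingularFoliation (M : SmoothMfd.{u}) where
  /-- The leaves. -/
  leaves : Set (Set M)
  isPartition : Setoid.IsPartition leaves
  isLeaf : ∀ L ∈ leaves, ∃ k : ℕ,
    IsConnectedWeaklyEmbedded L k ∧ ∀ x ∈ L, HasAdaptedChart leaves k x

/-- The singular distribution `TF ⊆ TM`, the union of the tangent spaces `T_x L` of the leaves. -/
def SingularFoliation.tangentDistribution {M : SmoothMfd.{u}} (F : SingularFoliation M) :
    Set (TangentBundle (𝓡 M.dim) M) :=
  {v | ∃ L ∈ F.leaves, ∃ (X : SmoothMfd.{u}) (ι : X → M), IsWeakEmbeddingOnto ι L ∧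
    v ∈ Set.range (tangentMap (𝓡 X.dim) (𝓡 M.dim) ι)}

/-- A surjective submersion with connected fibers. -/
structure IsConnectedFiberSubmersion {M N : SmoothMfd.{u}} (p : M → N) : Prop where
  surjective : Function.Surjective p
  isSubmersion : Manifold.IsSubmersion (𝓡 M.dim) (𝓡 N.dim) ∞ p
  isConnected_fiber : ∀ y : N, IsConnected (p ⁻¹' {y})

/-- `F` is the pullback `p⁻¹ G` of the singular foliation `G` along `p`: the singular foliation
with distribution `(dp)⁻¹ (TG)`, whose leaves are the sets `p⁻¹ (L)` with `L` a leaf of `G`. -/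
structure IsPullback {M N : SmoothMfd.{u}} (p : M → N) (G : SingularFoliation N)
    (F : SingularFoliation M) : Prop where
  tangentDistribution_eq :
    F.tangentDistribution =
      tangentMap (𝓡 M.dim) (𝓡 N.dim) p ⁻¹' G.tangentDistribution
  leaves_eq : F.leaves = {S | ∃ L ∈ G.leaves, S = p ⁻¹' L}

/-- A manifold together with a singular foliation of it. -/
structure FoliatedMfd : Type (u + 1) where
  /-- The manifold. -/
  mfd : SmoothMfd.{u}
  /-- The singular foliation. -/
  foliation : SingularFoliation mfd

/-- Molino transverse equivalence of singular foliations. -/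
def MolinoTransverseEquivalent (A B : FoliatedMfd.{u}) : Prop :=
  ∃ (M : FoliatedMfd.{u}) (p : M.mfd → A.mfd) (q : M.mfd → B.mfd),
    IsConnectedFiberSubmersion p ∧ IsConnectedFiberSubmersion q ∧
    IsPullback p A.foliation M.foliation ∧ IsPullback q B.foliation M.foliation

end SingularFol

/-! Only transitivity has content. Given `A ← M → B` and `B ← M' → C`, form the fiber product `P = M
×_B M'`. Its projections are base changes of surjective submersions with connected fibers, hence of
the same kind, and so are their composites with the outer legs: a fiber of a composite is the
preimage of a closed connected set under an open surjection with connected fibers. Give `P` the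
pullback of the foliation of `M`. The square over `B` commutes, so by functoriality of pullback
(`IsPullback.iff_comp`) this is also the pullback from `B` through `M'`, hence the pullback of the
foliation of `M'`; functoriality again gives both outer legs.

It remains to see that pullbacks exist (`pullbackFoliation`, `isPullback_pullbackFoliation`). If `ι
: X → N` parametrizes a leaf `L`, then `p⁻¹(L)` is parametrized by `X ×_N M → M`. The fiber product
carries immersion, plots, connectedness and tangent spaces from `L` to `p⁻¹(L)`, and adapted charts
lift through local product charts of `p`. Submersions and immersions are handled through the normal
forms `IsLocallyProduct` and `IsSliceChart`. -/

namespace SingularFol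

open Set

/-! ### Partial diffeomorphisms and rearrangement of product factors. -/

section PartialDiffeo

variable {E₁ E₂ E₃ E₄ H₁ H₂ H₃ H₄ M₁ M₂ M₃ M₄ : Type*}
  [NormedAddCommGroup E₁] [NormedSpace ℝ E₁] [NormedAddCommGroup E₂] [NormedSpace ℝ E₂]
  [NormedAddCommGroup E₃] [NormedSpace ℝ E₃] [NormedAddCommGroup E₄] [NormedSpace ℝ E₄]
  [TopologicalSpace H₁] [TopologicalSpace H₂] [TopologicalSpace H₃] [TopologicalSpace H₄]
  {I₁ : ModelWithCorners ℝ E₁ H₁} {I₂ : ModelWithCorners ℝ E₂ H₂}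
  {I₃ : ModelWithCorners ℝ E₃ H₃} {I₄ : ModelWithCorners ℝ E₄ H₄}
  [TopologicalSpace M₁] [ChartedSpace H₁ M₁] [TopologicalSpace M₂] [ChartedSpace H₂ M₂]
  [TopologicalSpace M₃] [ChartedSpace H₃ M₃] [TopologicalSpace M₄] [ChartedSpace H₄ M₄]

/-- A partial homeomorphism between open sets which is smooth in both directions. -/
structure IsPartialDiffeo (I₁ : ModelWithCorners ℝ E₁ H₁) (I₂ : ModelWithCorners ℝ E₂ H₂)
    (e : OpenPartialHomeomorph M₁ M₂) : Prop where
  contMDiffOn : ContMDiffOn I₁ I₂ ∞ e e.source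
  contMDiffOn_symm : ContMDiffOn I₂ I₁ ∞ e.symm e.target

namespace IsPartialDiffeo

theorem symm {e : OpenPartialHomeomorph M₁ M₂} (h : IsPartialDiffeo I₁ I₂ e) :
    IsPartialDiffeo I₂ I₁ e.symm :=
  ⟨h.contMDiffOn_symm, h.contMDiffOn⟩

theorem trans {e : OpenPartialHomeomorph M₁ M₂} {e' : OpenPartialHomeomorph M₂ M₃}
    (h : IsPartialDiffeo I₁ I₂ e) (h' : IsPartialDiffeo I₂ I₃ e') :
    IsPartialDiffeo I₁ I₃ (e.trans e') where
  contMDiffOn := h'.contMDiffOn.comp (h.contMDiffOn.mono inter_subset_left) inter_subset_right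
  contMDiffOn_symm :=
    h.contMDiffOn_symm.comp (h'.contMDiffOn_symm.mono inter_subset_left) inter_subset_right

theorem refl : IsPartialDiffeo I₁ I₁ (OpenPartialHomeomorph.refl M₁) :=
  ⟨contMDiffOn_id, contMDiffOn_id⟩

theorem prod {e : OpenPartialHomeomorph M₁ M₂} {e' : OpenPartialHomeomorph M₃ M₄}
    (h : IsPartialDiffeo I₁ I₂ e) (h' : IsPartialDiffeo I₃ I₄ e') :
    IsPartialDiffeo (I₁.prod I₃) (I₂.prod I₄) (e.prod e') where
  contMDiffOn := h.contMDiffOn.prodMap h'.contMDiffOn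
  contMDiffOn_symm := h.contMDiffOn_symm.prodMap h'.contMDiffOn_symm

theorem ofHomeomorph (e : M₁ ≃ₜ M₂) (h : ContMDiff I₁ I₂ ∞ e) (h' : ContMDiff I₂ I₁ ∞ e.symm) :
    IsPartialDiffeo I₁ I₂ e.toOpenPartialHomeomorph :=
  ⟨h.contMDiffOn, h'.contMDiffOn⟩

theorem restrOpen {e : OpenPartialHomeomorph M₁ M₂} (h : IsPartialDiffeo I₁ I₂ e) (s : Set M₁)
    (hs : IsOpen s) : IsPartialDiffeo I₁ I₂ (e.restrOpen s hs) where
  contMDiffOn := h.contMDiffOn.mono inter_subset_left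
  contMDiffOn_symm := h.contMDiffOn_symm.mono inter_subset_left

theorem of_mem_maximalAtlas [IsManifold I₁ ∞ M₁] {e : OpenPartialHomeomorph M₁ H₁}
    (h : e ∈ IsManifold.maximalAtlas I₁ ∞ M₁) : IsPartialDiffeo I₁ I₁ e :=
  ⟨contMDiffOn_of_mem_maximalAtlas h, contMDiffOn_symm_of_mem_maximalAtlas h⟩

theorem chartAt [IsManifold I₁ ∞ M₁] (x : M₁) : IsPartialDiffeo I₁ I₁ (chartAt H₁ x) :=
  of_mem_maximalAtlas (IsManifold.chart_mem_maximalAtlas x)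

theorem mem_maximalAtlas [IsManifold I₁ ∞ M₁] {e : OpenPartialHomeomorph M₁ H₁}
    (h : IsPartialDiffeo I₁ I₁ e) : e ∈ IsManifold.maximalAtlas I₁ ∞ M₁ :=
  e.mem_maximalAtlas_of_contMDiffOn h.contMDiffOn h.contMDiffOn_symm

theorem contMDiffAt {e : OpenPartialHomeomorph M₁ M₂} (h : IsPartialDiffeo I₁ I₂ e) {x : M₁}
    (hx : x ∈ e.source) : ContMDiffAt I₁ I₂ ∞ e x :=
  h.contMDiffOn.contMDiffAt (e.open_source.mem_nhds hx)

theorem contMDiffAt_symm {e : OpenPartialHomeomorph M₁ M₂} (h : IsPartialDiffeo I₁ I₂ e) {x : M₂}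
    (hx : x ∈ e.target) : ContMDiffAt I₂ I₁ ∞ e.symm x :=
  h.contMDiffOn_symm.contMDiffAt (e.open_target.mem_nhds hx)

end IsPartialDiffeo

end PartialDiffeo

section Reassociation

variable (A B C : Type*) [TopologicalSpace A] [TopologicalSpace B] [TopologicalSpace C]

/-- The exchange of the last two factors of a triple product. -/
def prodRightComm : (A × B) × C ≃ₜ (A × C) × B where
  toFun q := ((q.1.1, q.2), q.1.2)
  invFun q := ((q.1.1, q.2), q.1.2)
  left_inv _ := rfl
  right_inv _ := rfl
  continuous_toFun := by fun_prop
  continuous_invFun := by fun_prop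

variable {A B C} {EA EB EC HA HB HC : Type*} [NormedAddCommGroup EA] [NormedSpace ℝ EA]
  [NormedAddCommGroup EB] [NormedSpace ℝ EB] [NormedAddCommGroup EC] [NormedSpace ℝ EC]
  [TopologicalSpace HA] [TopologicalSpace HB] [TopologicalSpace HC]
  {IA : ModelWithCorners ℝ EA HA} {IB : ModelWithCorners ℝ EB HB} {IC : ModelWithCorners ℝ EC HC}
  [ChartedSpace HA A] [ChartedSpace HB B] [ChartedSpace HC C]

theorem contMDiff_prodRightComm :
    ContMDiff ((IA.prod IB).prod IC) ((IA.prod IC).prod IB) ∞ (prodRightComm A B C) :=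
  (contMDiff_fst.fst.prodMk contMDiff_snd).prodMk contMDiff_fst.snd

theorem isPartialDiffeo_prodRightComm :
    IsPartialDiffeo ((IA.prod IB).prod IC) ((IA.prod IC).prod IB)
      (prodRightComm A B C).toOpenPartialHomeomorph :=
  .ofHomeomorph _ contMDiff_prodRightComm
    (contMDiff_prodRightComm (A := A) (B := C) (C := B))

/-- The association of a triple product to the right. -/
theorem isPartialDiffeo_prodAssoc :
    IsPartialDiffeo ((IA.prod IB).prod IC) (IA.prod (IB.prod IC))
      (Homeomorph.prodAssoc A B C).toOpenPartialHomeomorph :=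
  .ofHomeomorph _ (contMDiff_fst.fst.prodMk (contMDiff_fst.snd.prodMk contMDiff_snd))
    ((contMDiff_fst.prodMk contMDiff_snd.fst).prodMk contMDiff_snd.snd)

end Reassociation

section EuclideanSum

/-- A linear identification of `ℝᵃ × ℝᵇ` with `ℝⁿ`, where `n = a + b`. -/
noncomputable def euclideanSum {a b n : ℕ} (h : a + b = n) :
    (EuclideanSpace ℝ (Fin a) × EuclideanSpace ℝ (Fin b)) ≃L[ℝ] EuclideanSpace ℝ (Fin n) :=
  ContinuousLinearEquiv.ofFinrankEq (by simp [h])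

theorem isPartialDiffeo_euclideanSum {a b n : ℕ} (h : a + b = n) :
    IsPartialDiffeo ((𝓡 a).prod (𝓡 b)) (𝓡 n)
      (euclideanSum h).toHomeomorph.toOpenPartialHomeomorph := by
  refine .ofHomeomorph _ (?_ : ContMDiff _ _ _ (euclideanSum h))
    (?_ : ContMDiff _ _ _ (euclideanSum h).symm)
  -- The product of the models must be rewritten as the model of the product space before ordinary
  -- smoothness applies.
  · rw [← modelWithCornersSelf_prod, chartedSpaceSelf_prod]
    exact (euclideanSum h).contDiff.contMDiff
  · rw [← modelWithCornersSelf_prod, chartedSpaceSelf_prod]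
    exact (euclideanSum h).symm.contDiff.contMDiff

end EuclideanSum

/-- The preimage of a closed connected set under an open surjection with connected fibers. -/
theorem isConnected_preimage_of_isOpenMap {X Y : Type*} [TopologicalSpace X] [TopologicalSpace Y]
    {f : X → Y} (hf : Continuous f) (ho : IsOpenMap f) (hs : Function.Surjective f)
    (hc : ∀ y, IsConnected (f ⁻¹' {y})) {t : Set Y} (ht : IsClosed t) (ht' : IsConnected t) :
    IsConnected (f ⁻¹' t) :=
  Topology.IsCoinducing.isConnected_preimage_of_isClosed hc
    (ho.isQuotientMap hf hs).isCoinducing ht ht'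

/-! ### Local normal forms of submersions and immersions. -/

/-- A partial diffeomorphism of the form `m ↦ (p m, s m)`, which turns `p` into a projection. -/
structure IsProductChart {M N : SmoothMfd.{u}} {c : ℕ} (p : M → N)
    (e : OpenPartialHomeomorph M (N × EuclideanSpace ℝ (Fin c))) : Prop where
  isPartialDiffeo : IsPartialDiffeo (𝓡 M.dim) ((𝓡 N.dim).prod (𝓡 c)) e
  fst_apply : ∀ m ∈ e.source, (e m).1 = p m

/-- About every point, the map `p` is a projection with fiber of dimension `c`. -/
def IsLocallyProduct {M N : SmoothMfd.{u}} (p : M → N) (c : ℕ) : Prop :=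
  ∀ m, N.dim + c = M.dim ∧
    ∃ e : OpenPartialHomeomorph M (N × EuclideanSpace ℝ (Fin c)), IsProductChart p e ∧ m ∈ e.source

/-- A partial diffeomorphism which turns the restriction of `ι` to the open set `O` into the
inclusion `x ↦ (x, 0)`. -/
structure IsSliceChart {X N : SmoothMfd.{u}} {d : ℕ} (ι : X → N) (O : Set X)
    (e : OpenPartialHomeomorph N (X × EuclideanSpace ℝ (Fin d))) : Prop where
  isPartialDiffeo : IsPartialDiffeo (𝓡 N.dim) ((𝓡 X.dim).prod (𝓡 d)) e
  isOpen : IsOpen O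
  mapsTo : MapsTo ι O e.source
  apply_eq : ∀ x ∈ O, e (ι x) = (x, 0)

namespace IsProductChart

variable {M N K : SmoothMfd.{u}} {b c : ℕ} {p : M → N} {q : N → K}
  {e : OpenPartialHomeomorph M (N × EuclideanSpace ℝ (Fin c))}

theorem apply_symm (h : IsProductChart p e) {z : N × EuclideanSpace ℝ (Fin c)}
    (hz : z ∈ e.target) : p (e.symm z) = z.1 := by
  rw [← h.fst_apply _ (e.map_target hz), e.right_inv hz]

theorem contMDiffAt (h : IsProductChart p e) {m : M} (hm : m ∈ e.source) :
    ContMDiffAt (𝓡 M.dim) (𝓡 N.dim) ∞ p m :=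
  (h.isPartialDiffeo.contMDiffAt hm).fst.congr_of_eventuallyEq <|
    Filter.eventuallyEq_of_mem (e.open_source.mem_nhds hm) fun m' hm' ↦ (h.fst_apply m' hm').symm

/-- Straighten `p`, then straighten `q` on the base factor; the two fiber directions merge into one
`ℝᵇ⁺ᶜ`. -/
theorem comp (h : IsProductChart p e)
    {e' : OpenPartialHomeomorph N (K × EuclideanSpace ℝ (Fin b))} (h' : IsProductChart q e') :
    IsProductChart (q ∘ p) ((e.trans (e'.prod (.refl _))).trans
      ((Homeomorph.prodAssoc _ _ _).toOpenPartialHomeomorph.trans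
        ((OpenPartialHomeomorph.refl K).prod
          (euclideanSum (rfl : b + c = b + c)).toHomeomorph.toOpenPartialHomeomorph))) where
  isPartialDiffeo := (h.isPartialDiffeo.trans (h'.isPartialDiffeo.prod .refl)).trans
    (isPartialDiffeo_prodAssoc.trans (.prod .refl (isPartialDiffeo_euclideanSum rfl)))
  fst_apply m hm := by
    have hm' : m ∈ e.source ∧ (e m).1 ∈ e'.source := by simpa using hm
    exact (h'.fst_apply _ hm'.2).trans (congrArg q (h.fst_apply m hm'.1))

end IsProductChart

namespace IsLocallyProduct

variable {M N K : SmoothMfd.{u}} {b c : ℕ} {p : M → N} {q : N → K}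

theorem contMDiff (h : IsLocallyProduct p c) : ContMDiff (𝓡 M.dim) (𝓡 N.dim) ∞ p := fun m ↦ by
  obtain ⟨-, e, he, hm⟩ := h m
  exact he.contMDiffAt hm

theorem isOpenMap (h : IsLocallyProduct p c) : IsOpenMap p := by
  refine IsOpenMap.of_nhds_le fun m ↦ ?_
  obtain ⟨-, e, he, hm⟩ := h m
  have : p =ᶠ[nhds m] Prod.fst ∘ e :=
    Filter.eventuallyEq_of_mem (e.open_source.mem_nhds hm) fun m' hm' ↦ (he.fst_apply m' hm').symm
  rw [Filter.map_congr this, ← Filter.map_map, e.map_nhds_eq hm, ← he.fst_apply m hm]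
  exact isOpenMap_fst.nhds_le _

theorem comp (hp : IsLocallyProduct p c) (hq : IsLocallyProduct q b) :
    IsLocallyProduct (q ∘ p) (b + c) := fun m ↦ by
  obtain ⟨hd, e, he, hm⟩ := hp m
  obtain ⟨hd', e', he', hm'⟩ := hq (p m)
  refine ⟨by omega, _, he.comp he', ?_⟩
  have : (e m).1 ∈ e'.source := by rwa [he.fst_apply m hm]
  simpa using ⟨hm, this⟩

theorem isSubmersion (h : IsLocallyProduct p c) :
    Manifold.IsSubmersion (𝓡 M.dim) (𝓡 N.dim) ∞ p := by
  suffices Manifold.IsSubmersionOfComplement (EuclideanSpace ℝ (Fin c)) (𝓡 M.dim) (𝓡 N.dim) ∞ p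
    from this.isSubmersion
  intro m
  obtain ⟨hd, e, he, hm⟩ := h m
  have hchart := he.isPartialDiffeo.trans
    ((IsPartialDiffeo.prod (.chartAt (p m)) .refl).trans (isPartialDiffeo_euclideanSum hd))
  refine Manifold.IsSubmersionAtOfComplement.mk_of_continuousAt h.contMDiff.continuous.continuousAt
    (euclideanSum hd).symm _ (chartAt _ (p m)) ?_ (mem_chart_source _ _)
    hchart.mem_maximalAtlas (IsManifold.chart_mem_maximalAtlas _) ?_
  · simpa [he.fst_apply m hm] using hm
  · intro z hz
    have hz' : ((chartAt (EuclideanSpace ℝ (Fin N.dim)) (p m)).symm ((euclideanSum hd).symm z).1,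
        ((euclideanSum hd).symm z).2) ∈ e.target ∧
        ((euclideanSum hd).symm z).1 ∈
          (chartAt (EuclideanSpace ℝ (Fin N.dim)) (p m)).target := by
      simpa [and_comm] using hz
    simp [he.apply_symm hz'.1, (chartAt _ (p m)).right_inv hz'.2]

/-- The abstract complement in the normal form is a linear quotient of a Euclidean space, so it can
be replaced by `ℝᶜ`; undoing the chart of `N` makes the base factor `N` itself. The subtraction is
not truncated once `M` has a point. -/
theorem of_isSubmersion (h : Manifold.IsSubmersion (𝓡 M.dim) (𝓡 N.dim) ∞ p) :
    IsLocallyProduct p (M.dim - N.dim) := fun m ↦ by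
  have hc := h.isSubmersionOfComplement_complement m
  let L := hc.equiv
  have hfin : FiniteDimensional ℝ h.complement :=
    Module.Finite.of_surjective (LinearMap.snd ℝ _ _ ∘ₗ L.toLinearEquiv.toLinearMap)
      fun y ↦ ⟨L.symm (0, y), by simp⟩
  have hd : M.dim = N.dim + Module.finrank ℝ h.complement := by
    simpa using L.toLinearEquiv.finrank_eq
  let F : h.complement ≃L[ℝ] EuclideanSpace ℝ (Fin (M.dim - N.dim)) :=
    ContinuousLinearEquiv.ofFinrankEq (by simp [hd])
  let L' := L.trans ((ContinuousLinearEquiv.refl ℝ _).prodCongr F)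
  have hL : IsPartialDiffeo (𝓡 M.dim) ((𝓡 N.dim).prod (𝓡 (M.dim - N.dim)))
      L'.toHomeomorph.toOpenPartialHomeomorph := by
    refine .ofHomeomorph _ (?_ : ContMDiff _ _ _ L') (?_ : ContMDiff _ _ _ L'.symm)
    · rw [← modelWithCornersSelf_prod, chartedSpaceSelf_prod]
      exact L'.contDiff.contMDiff
    · rw [← modelWithCornersSelf_prod, chartedSpaceSelf_prod]
      exact L'.symm.contDiff.contMDiff
  have key : ∀ m' ∈ hc.domChart.source, hc.codChart (p m') = (L (hc.domChart m')).1 := by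
    intro m' hm'
    have hm : hc.domChart m' ∈ (hc.domChart.extend (𝓡 M.dim)).target := by
      simpa using hc.domChart.map_source hm'
    have := hc.writtenInCharts hm
    simpa [hm'] using this
  refine ⟨by omega, _, ⟨((IsPartialDiffeo.of_mem_maximalAtlas hc.domChart_mem_maximalAtlas).trans
    hL).trans (IsPartialDiffeo.prod
      (IsPartialDiffeo.of_mem_maximalAtlas hc.codChart_mem_maximalAtlas).symm .refl), ?_⟩, ?_⟩
  · intro m' hm'
    have hm'' : m' ∈ hc.domChart.source := by
      simp only [OpenPartialHomeomorph.trans_source] at hm'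
      exact hm'.1.1
    simp [L', ← key m' hm'', hc.codChart.left_inv (hc.source_subset_preimage_source hm'')]
  · have := hc.codChart.map_source hc.mem_codChart_source
    rw [key m hc.mem_domChart_source] at this
    simpa [L', hc.mem_domChart_source] using this

end IsLocallyProduct

section Immersion

variable {X N : SmoothMfd.{u}} {ι : X → N}

theorem IsSliceChart.contMDiffAt {d : ℕ} {O : Set X}
    {e : OpenPartialHomeomorph N (X × EuclideanSpace ℝ (Fin d))} (h : IsSliceChart ι O e) {x : X}
    (hx : x ∈ O) : ContMDiffAt (𝓡 X.dim) (𝓡 N.dim) ∞ ι x := by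
  have h₁ : ∀ x' ∈ O, e.symm (x', 0) = ι x' := fun x' hx' ↦ by
    rw [← h.apply_eq x' hx', e.left_inv (h.mapsTo hx')]
  have h₂ : (x, 0) ∈ e.target := h.apply_eq x hx ▸ e.map_source (h.mapsTo hx)
  have h₃ := (h.isPartialDiffeo.contMDiffAt_symm h₂).comp x
    (contMDiffAt_id.prodMk contMDiffAt_const)
  exact h₃.congr_of_eventuallyEq <|
    Filter.eventuallyEq_of_mem (h.isOpen.mem_nhds hx) fun x' hx' ↦ (h₁ x' hx').symm

theorem isImmersion_of_isSliceChart {d : ℕ} (hd : X.dim + d = N.dim)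
    (h : ∀ x, ∃ (O : Set X) (e : OpenPartialHomeomorph N (X × EuclideanSpace ℝ (Fin d))),
      IsSliceChart ι O e ∧ x ∈ O) :
    Manifold.IsImmersion (𝓡 X.dim) (𝓡 N.dim) ∞ ι := by
  suffices Manifold.IsImmersionOfComplement (EuclideanSpace ℝ (Fin d)) (𝓡 X.dim) (𝓡 N.dim) ∞ ι
    from this.isImmersion
  intro x
  obtain ⟨O, e, he, hx⟩ := h x
  have hchart := he.isPartialDiffeo.trans
    ((IsPartialDiffeo.prod (.chartAt x) .refl).trans (isPartialDiffeo_euclideanSum hd))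
  refine Manifold.IsImmersionAtOfComplement.mk_of_continuousAt (he.contMDiffAt hx).continuousAt
    (euclideanSum hd) _ _ ?_ ?_
    -- The slice formula holds only on `O`, so the chart of `X` is restricted to it.
    ((IsPartialDiffeo.chartAt x).restrOpen O he.isOpen).mem_maximalAtlas hchart.mem_maximalAtlas ?_
  · simpa using hx
  · simpa [he.apply_eq x hx] using he.mapsTo hx
  · intro z hz
    have hz' : (chartAt (EuclideanSpace ℝ (Fin X.dim)) x).symm z ∈ O ∧
        z ∈ (chartAt (EuclideanSpace ℝ (Fin X.dim)) x).target := by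
      simpa [and_comm] using hz
    simp [he.apply_eq _ hz'.1, (chartAt _ x).right_inv hz'.2]

theorem exists_isSliceChart (h : Manifold.IsImmersion (𝓡 X.dim) (𝓡 N.dim) ∞ ι) (x : X) :
    X.dim + (N.dim - X.dim) = N.dim ∧ ∃ (O : Set X)
      (e : OpenPartialHomeomorph N (X × EuclideanSpace ℝ (Fin (N.dim - X.dim)))),
      IsSliceChart ι O e ∧ x ∈ O := by
  have hc := h.isImmersionOfComplement_complement x
  let L := hc.equiv
  have hfin : FiniteDimensional ℝ h.complement :=
    Module.Finite.of_surjective (LinearMap.snd ℝ _ _ ∘ₗ L.symm.toLinearEquiv.toLinearMap)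
      fun y ↦ ⟨L (0, y), by simp⟩
  have hd : N.dim = X.dim + Module.finrank ℝ h.complement := by
    simpa using L.symm.toLinearEquiv.finrank_eq
  let F : h.complement ≃L[ℝ] EuclideanSpace ℝ (Fin (N.dim - X.dim)) :=
    ContinuousLinearEquiv.ofFinrankEq (by simp [hd])
  let L' := L.symm.trans ((ContinuousLinearEquiv.refl ℝ _).prodCongr F)
  have hL : IsPartialDiffeo (𝓡 N.dim) ((𝓡 X.dim).prod (𝓡 (N.dim - X.dim)))
      L'.toHomeomorph.toOpenPartialHomeomorph := by
    refine .ofHomeomorph _ (?_ : ContMDiff _ _ _ L') (?_ : ContMDiff _ _ _ L'.symm)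
    · rw [← modelWithCornersSelf_prod, chartedSpaceSelf_prod]
      exact L'.contDiff.contMDiff
    · rw [← modelWithCornersSelf_prod, chartedSpaceSelf_prod]
      exact L'.symm.contDiff.contMDiff
  have key : ∀ x' ∈ hc.domChart.source, L.symm (hc.codChart (ι x')) = (hc.domChart x', 0) := by
    intro x' hx'
    have hm : hc.domChart x' ∈ (hc.domChart.extend (𝓡 X.dim)).target := by
      simpa using hc.domChart.map_source hx'
    have := hc.writtenInCharts hm
    rw [ContinuousLinearEquiv.symm_apply_eq]
    simpa [hx'] using this
  refine ⟨by omega, hc.domChart.source, _,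
    ⟨((IsPartialDiffeo.of_mem_maximalAtlas hc.codChart_mem_maximalAtlas).trans
      hL).trans (IsPartialDiffeo.prod
      (IsPartialDiffeo.of_mem_maximalAtlas hc.domChart_mem_maximalAtlas).symm .refl),
      hc.domChart.open_source, ?_, ?_⟩, hc.mem_domChart_source⟩
  · intro x' hx'
    simpa [L', key x' hx', hx'] using hc.source_subset_preimage_source hx'
  · intro x' hx'
    simp [L', key x' hx', hx']

end Immersion

/-! ### The fiber product of a smooth map and a submersion. -/

/-- The fiber product of `f : X → N` and `p : M → N`. -/
def FiberProduct {X M N : SmoothMfd.{u}} (f : X → N) (p : M → N) : Type u :=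
  {q : X × M // f q.1 = p q.2}

namespace FiberProduct

variable {X M N : SmoothMfd.{u}} {f : X → N} {p : M → N} {c : ℕ}

instance : TopologicalSpace (FiberProduct f p) := inferInstanceAs (TopologicalSpace (Subtype _))

instance : T2Space (FiberProduct f p) := inferInstanceAs (T2Space (Subtype _))

instance : SecondCountableTopology (FiberProduct f p) :=
  Topology.IsInducing.subtypeVal.secondCountableTopology

/-- The first projection. -/
def fst (q : FiberProduct f p) : X := q.1.1

/-- The second projection. -/
def snd (q : FiberProduct f p) : M := q.1.2

theorem condition (q : FiberProduct f p) : f q.fst = p q.snd := q.2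

theorem ext {q q' : FiberProduct f p} (h : q.fst = q'.fst) (h' : q.snd = q'.snd) : q = q' :=
  Subtype.ext (Prod.ext h h')

theorem isInducing_prodMk :
    Topology.IsInducing fun q : FiberProduct f p ↦ (q.fst, q.snd) :=
  .subtypeVal

theorem continuous_fst : Continuous (fst : FiberProduct f p → X) :=
  _root_.continuous_fst.comp continuous_subtype_val

theorem continuous_snd : Continuous (snd : FiberProduct f p → M) :=
  _root_.continuous_snd.comp continuous_subtype_val

open scoped Classical in
/-- The pair `(x, m)` if it lies in the fiber product, and the given point `q` otherwise. -/
noncomputable def mkD (q : FiberProduct f p) (z : X × M) : FiberProduct f p :=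
  if h : f z.1 = p z.2 then ⟨z, h⟩ else q

theorem fst_mkD (q : FiberProduct f p) {z : X × M} (h : f z.1 = p z.2) : (mkD q z).fst = z.1 := by
  simp [mkD, h, fst]

theorem snd_mkD (q : FiberProduct f p) {z : X × M} (h : f z.1 = p z.2) : (mkD q z).snd = z.2 := by
  simp [mkD, h, snd]

variable {e : OpenPartialHomeomorph M (N × EuclideanSpace ℝ (Fin c))}

theorem condition_symm (he : IsProductChart p e) {z : X × EuclideanSpace ℝ (Fin c)}
    (hz : (f z.1, z.2) ∈ e.target) : f z.1 = p (e.symm (f z.1, z.2)) :=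
  (he.apply_symm hz).symm

/-- The base change along `f` of a product chart of `p`. -/
noncomputable def baseChange (hf : Continuous f) (he : IsProductChart p e)
    (q₀ : FiberProduct f p) :
    OpenPartialHomeomorph (FiberProduct f p) (X × EuclideanSpace ℝ (Fin c)) where
  toFun q := (q.fst, (e q.snd).2)
  -- The point `q₀` is only a default value off the target.
  invFun z := mkD q₀ (z.1, e.symm (f z.1, z.2))
  source := snd ⁻¹' e.source
  target := {z | (f z.1, z.2) ∈ e.target}
  map_source' q hq := by
    have : (f q.fst, (e q.snd).2) = e q.snd :=
      Prod.ext (q.condition.trans (he.fst_apply _ hq).symm) rfl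
    simpa [this] using e.map_source hq
  map_target' z hz := by
    rw [mem_preimage, snd_mkD _ (condition_symm he hz)]
    exact e.map_target hz
  left_inv' q hq := by
    have h : (f q.fst, (e q.snd).2) = e q.snd :=
      Prod.ext (q.condition.trans (he.fst_apply _ hq).symm) rfl
    have h' : e.symm (f q.fst, (e q.snd).2) = q.snd := by rw [h, e.left_inv hq]
    have h'' : f q.fst = p (e.symm (f q.fst, (e q.snd).2)) := by rw [h', q.condition]
    exact ext (fst_mkD _ h'') ((snd_mkD _ h'').trans h')
  right_inv' z hz := by
    rw [fst_mkD _ (condition_symm he hz), snd_mkD _ (condition_symm he hz), e.right_inv hz]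
  open_source := e.open_source.preimage continuous_snd
  open_target := e.open_target.preimage (by fun_prop)
  continuousOn_toFun := continuous_fst.continuousOn.prodMk <| continuousOn_snd.comp
    (e.continuousOn.comp continuous_snd.continuousOn fun _ h ↦ h) (mapsTo_univ _ _)
  continuousOn_invFun := by
    rw [isInducing_prodMk.continuousOn_iff]
    refine ContinuousOn.congr (f := fun z ↦ (z.1, e.symm (f z.1, z.2))) ?_ fun z hz ↦ ?_
    · exact continuousOn_fst.prodMk (e.continuousOn_symm.comp (by fun_prop) fun _ h ↦ h)
    · simp only [Function.comp_apply]
      rw [fst_mkD _ (condition_symm he hz), snd_mkD _ (condition_symm he hz)]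

theorem fst_baseChange_symm (hf : Continuous f) (he : IsProductChart p e) (q₀ : FiberProduct f p)
    {z : X × EuclideanSpace ℝ (Fin c)} (hz : (f z.1, z.2) ∈ e.target) :
    ((baseChange hf he q₀).symm z).fst = z.1 :=
  fst_mkD _ (condition_symm he hz)

theorem snd_baseChange_symm (hf : Continuous f) (he : IsProductChart p e) (q₀ : FiberProduct f p)
    {z : X × EuclideanSpace ℝ (Fin c)} (hz : (f z.1, z.2) ∈ e.target) :
    ((baseChange hf he q₀).symm z).snd = e.symm (f z.1, z.2) :=
  snd_mkD _ (condition_symm he hz)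

/-- A chart of the fiber product about the point `q`. -/
noncomputable def chart (hf : Continuous f) (hp : IsLocallyProduct p c) (q : FiberProduct f p) :
    OpenPartialHomeomorph (FiberProduct f p) (EuclideanSpace ℝ (Fin (X.dim + c))) :=
  (baseChange hf (hp q.snd).2.choose_spec.1 q).trans
    (((chartAt (EuclideanSpace ℝ (Fin X.dim)) q.fst).prod (.refl _)).trans
      (euclideanSum rfl).toHomeomorph.toOpenPartialHomeomorph)

theorem mem_chart_source (hf : Continuous f) (hp : IsLocallyProduct p c) (q : FiberProduct f p) :
    q ∈ (chart hf hp q).source := by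
  have h₁ : q ∈ (baseChange hf (hp q.snd).2.choose_spec.1 q).source :=
    (hp q.snd).2.choose_spec.2
  have h₂ : (baseChange hf (hp q.snd).2.choose_spec.1 q q).1 ∈
      (chartAt (EuclideanSpace ℝ (Fin X.dim)) q.fst).source := ChartedSpace.mem_chart_source _
  simpa [chart] using ⟨h₁, h₂⟩

section

variable {E H Z : Type*} [NormedAddCommGroup E] [NormedSpace ℝ E] [TopologicalSpace H]
  {I : ModelWithCorners ℝ E H} [TopologicalSpace Z] [ChartedSpace H Z]

/-- The charts of the fiber product are smooth along maps whose two components are smooth. -/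
theorem contMDiffOn_chart_comp (hf : Continuous f) (hp : IsLocallyProduct p c)
    (q : FiberProduct f p) {g : Z → FiberProduct f p} {s : Set Z}
    (h₁ : ContMDiffOn I (𝓡 X.dim) ∞ (fst ∘ g) s) (h₂ : ContMDiffOn I (𝓡 M.dim) ∞ (snd ∘ g) s)
    (hs : MapsTo g s (chart hf hp q).source) :
    ContMDiffOn I (𝓡 (X.dim + c)) ∞ (chart hf hp q ∘ g) s := by
  have he := (hp q.snd).2.choose_spec.1
  have hs' : ∀ z ∈ s, (g z).snd ∈ (hp q.snd).2.choose.source ∧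
      (g z).fst ∈ (chartAt (EuclideanSpace ℝ (Fin X.dim)) q.fst).source := by
    intro z hz
    have := hs hz
    simp only [chart, OpenPartialHomeomorph.trans_source, mem_inter_iff] at this
    exact ⟨this.1, this.2.1.1⟩
  have h₃ := contMDiff_snd.comp_contMDiffOn
    (he.isPartialDiffeo.contMDiffOn.comp h₂ fun z hz ↦ (hs' z hz).1)
  have h₄ := (IsPartialDiffeo.chartAt q.fst).contMDiffOn.comp h₁ fun z hz ↦ (hs' z hz).2
  exact (isPartialDiffeo_euclideanSum rfl).contMDiffOn.comp (h₄.prodMk h₃) (mapsTo_univ _ _)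

end

theorem chart_target_subset (hf : Continuous f) (hp : IsLocallyProduct p c)
    (q : FiberProduct f p) {z : EuclideanSpace ℝ (Fin (X.dim + c))}
    (hz : z ∈ (chart hf hp q).target) :
    ((euclideanSum rfl).symm z).1 ∈ (chartAt (EuclideanSpace ℝ (Fin X.dim)) q.fst).target ∧
    (f ((chartAt (EuclideanSpace ℝ (Fin X.dim)) q.fst).symm ((euclideanSum rfl).symm z).1),
      ((euclideanSum rfl).symm z).2) ∈ (hp q.snd).2.choose.target := by
  simp only [chart, OpenPartialHomeomorph.trans_target, mem_inter_iff] at hz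
  exact ⟨hz.1.2.1, hz.2⟩

theorem contMDiffOn_fst_chart_symm (hf : Continuous f) (hp : IsLocallyProduct p c)
    (q : FiberProduct f p) :
    ContMDiffOn (𝓡 (X.dim + c)) (𝓡 X.dim) ∞ (fst ∘ (chart hf hp q).symm)
      (chart hf hp q).target := by
  have h₁ := (isPartialDiffeo_euclideanSum (a := X.dim) (b := c) rfl).contMDiffOn_symm.mono
    (subset_univ (chart hf hp q).target)
  refine ((IsPartialDiffeo.chartAt q.fst).contMDiffOn_symm.comp (contMDiff_fst.comp_contMDiffOn h₁)
    fun z hz ↦ (chart_target_subset hf hp q hz).1).congr fun z hz ↦ ?_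
  exact fst_baseChange_symm hf (hp q.snd).2.choose_spec.1 q (chart_target_subset hf hp q hz).2

/-- The second component is `e.symm (f x, s)`. Here smoothness of `f` enters the atlas; elsewhere in
it continuity is enough. -/
theorem contMDiffOn_snd_chart_symm (hf : ContMDiff (𝓡 X.dim) (𝓡 N.dim) ∞ f)
    (hp : IsLocallyProduct p c) (q : FiberProduct f p) :
    ContMDiffOn (𝓡 (X.dim + c)) (𝓡 M.dim) ∞ (snd ∘ (chart hf.continuous hp q).symm)
      (chart hf.continuous hp q).target := by
  have h₁ := (isPartialDiffeo_euclideanSum (a := X.dim) (b := c) rfl).contMDiffOn_symm.mono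
    (subset_univ (chart hf.continuous hp q).target)
  have h₂ := (IsPartialDiffeo.chartAt q.fst).contMDiffOn_symm.comp (contMDiff_fst.comp_contMDiffOn h₁)
    fun z hz ↦ (chart_target_subset hf.continuous hp q hz).1
  refine ((hp q.snd).2.choose_spec.1.isPartialDiffeo.contMDiffOn_symm.comp
    ((hf.comp_contMDiffOn h₂).prodMk (contMDiff_snd.comp_contMDiffOn h₁))
    fun z hz ↦ (chart_target_subset hf.continuous hp q hz).2).congr fun z hz ↦ ?_
  exact snd_baseChange_symm hf.continuous (hp q.snd).2.choose_spec.1 q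
    (chart_target_subset hf.continuous hp q hz).2

/-- The atlas of the fiber product. -/
@[reducible]
noncomputable def chartedSpace (hf : Continuous f) (hp : IsLocallyProduct p c) :
    ChartedSpace (EuclideanSpace ℝ (Fin (X.dim + c))) (FiberProduct f p) where
  atlas := range (chart hf hp)
  chartAt := chart hf hp
  mem_chart_source := mem_chart_source hf hp
  chart_mem_atlas := mem_range_self

/-- A transition map is a chart after an inverse chart; the inverse chart has smooth components, and
charts are smooth along such maps. -/
theorem isManifold (hf : ContMDiff (𝓡 X.dim) (𝓡 N.dim) ∞ f) (hp : IsLocallyProduct p c) :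
    letI := chartedSpace hf.continuous hp
    IsManifold (𝓡 (X.dim + c)) ∞ (FiberProduct f p) := by
  let := chartedSpace hf.continuous hp
  refine isManifold_of_contDiffOn _ _ _ ?_
  rintro _ _ ⟨q, rfl⟩ ⟨q', rfl⟩
  simp only [modelWithCornersSelf_coe, modelWithCornersSelf_coe_symm, Function.id_comp,
    Function.comp_id, preimage_id, range_id, inter_univ, ← contMDiffOn_iff_contDiffOn]
  exact contMDiffOn_chart_comp hf.continuous hp q'
    ((contMDiffOn_fst_chart_symm hf.continuous hp q).mono inter_subset_left)
    ((contMDiffOn_snd_chart_symm hf hp q).mono inter_subset_left) inter_subset_right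

end FiberProduct

open FiberProduct

section FiberProductMfd

variable {X M N : SmoothMfd.{u}} {f : X → N} {p : M → N} {c : ℕ}

/-- The fiber product of a smooth map and a submersion, as a manifold. -/
noncomputable def fiberProductMfd (hf : ContMDiff (𝓡 X.dim) (𝓡 N.dim) ∞ f)
    (hp : IsLocallyProduct p c) : SmoothMfd.{u} :=
  letI := chartedSpace hf.continuous hp
  haveI := FiberProduct.isManifold hf hp
  { carrier := FiberProduct f p
    dim := X.dim + c }

variable (hf : ContMDiff (𝓡 X.dim) (𝓡 N.dim) ∞ f) (hp : IsLocallyProduct p c)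

/-- The first projection of the fiber product. -/
def fiberProductFst : fiberProductMfd hf hp → X := FiberProduct.fst

/-- The second projection of the fiber product. -/
def fiberProductSnd : fiberProductMfd hf hp → M := FiberProduct.snd

theorem contMDiff_fiberProductFst :
    ContMDiff (𝓡 (fiberProductMfd hf hp).dim) (𝓡 X.dim) ∞ (fiberProductFst hf hp) := fun q ↦ by
  have hq := mem_chart_source hf.continuous hp q
  -- The preferred chart at `q` is `chart hf.continuous hp q` by definition.
  have h := (IsPartialDiffeo.chartAt (I₁ := 𝓡 (fiberProductMfd hf hp).dim) q).contMDiffAt hq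
  have h' := (contMDiffOn_fst_chart_symm hf.continuous hp q).contMDiffAt
    ((chart hf.continuous hp q).open_target.mem_nhds ((chart hf.continuous hp q).map_source hq))
  refine (h'.comp q h).congr_of_eventuallyEq <| Filter.eventuallyEq_of_mem
    ((chart hf.continuous hp q).open_source.mem_nhds hq) fun q' hq' ↦ ?_
  exact congrArg FiberProduct.fst ((chart hf.continuous hp q).left_inv hq').symm

theorem contMDiff_fiberProductSnd :
    ContMDiff (𝓡 (fiberProductMfd hf hp).dim) (𝓡 M.dim) ∞ (fiberProductSnd hf hp) := fun q ↦ by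
  have hq := mem_chart_source hf.continuous hp q
  have h := (IsPartialDiffeo.chartAt (I₁ := 𝓡 (fiberProductMfd hf hp).dim) q).contMDiffAt hq
  have h' := (contMDiffOn_snd_chart_symm hf hp q).contMDiffAt
    ((chart hf.continuous hp q).open_target.mem_nhds ((chart hf.continuous hp q).map_source hq))
  refine (h'.comp q h).congr_of_eventuallyEq <| Filter.eventuallyEq_of_mem
    ((chart hf.continuous hp q).open_source.mem_nhds hq) fun q' hq' ↦ ?_
  exact congrArg FiberProduct.snd ((chart hf.continuous hp q).left_inv hq').symm

/-- The universal property of the fiber product, locally. -/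
theorem contMDiffOn_fiberProduct {E H Z : Type*} [NormedAddCommGroup E] [NormedSpace ℝ E]
    [TopologicalSpace H] {I : ModelWithCorners ℝ E H} [TopologicalSpace Z] [ChartedSpace H Z]
    {g : Z → fiberProductMfd hf hp} {s : Set Z} (hs : IsOpen s)
    (h₁ : ContMDiffOn I (𝓡 X.dim) ∞ (fiberProductFst hf hp ∘ g) s)
    (h₂ : ContMDiffOn I (𝓡 M.dim) ∞ (fiberProductSnd hf hp ∘ g) s) :
    ContMDiffOn I (𝓡 (fiberProductMfd hf hp).dim) ∞ g s := by
  have hg : ContinuousOn g s :=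
    (isInducing_prodMk (f := f) (p := p)).continuousOn_iff.2
      (h₁.continuousOn.prodMk h₂.continuousOn)
  intro z hz
  set e := chart hf.continuous hp (g z)
  have hgz : g z ∈ e.source := mem_chart_source hf.continuous hp (g z)
  have ho : IsOpen (s ∩ g ⁻¹' e.source) := hg.isOpen_inter_preimage hs e.open_source
  have h := contMDiffOn_chart_comp hf.continuous hp (g z) (h₁.mono inter_subset_left)
    (h₂.mono inter_subset_left) (inter_subset_right (s := s) (t := g ⁻¹' e.source))
  have h' := (IsPartialDiffeo.chartAt (I₁ := 𝓡 (fiberProductMfd hf hp).dim)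
    (g z)).contMDiffOn_symm.comp h fun y hy ↦ e.map_source hy.2
  have h'' : ContMDiffAt I (𝓡 (fiberProductMfd hf hp).dim) ∞ g z :=
    (h'.contMDiffAt (ho.mem_nhds ⟨hz, hgz⟩)).congr_of_eventuallyEq <|
      Filter.eventuallyEq_of_mem (ho.mem_nhds ⟨hz, hgz⟩) fun y hy ↦ (e.left_inv hy.2).symm
  exact h''.contMDiffWithinAt

variable {e : OpenPartialHomeomorph M (N × EuclideanSpace ℝ (Fin c))}

/-- The base change of a product chart of `p`, as a product chart of the first projection. -/
theorem isProductChart_baseChange (he : IsProductChart p e) (q : FiberProduct f p) :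
    IsProductChart (fiberProductFst hf hp) (baseChange hf.continuous he q) where
  isPartialDiffeo :=
    { contMDiffOn := (contMDiff_fiberProductFst hf hp).contMDiffOn.prodMk
        (contMDiff_snd.comp_contMDiffOn <| he.isPartialDiffeo.contMDiffOn.comp
          (contMDiff_fiberProductSnd hf hp).contMDiffOn fun _ h ↦ h)
      contMDiffOn_symm := by
        refine contMDiffOn_fiberProduct hf hp (baseChange hf.continuous he q).open_target ?_ ?_
        · exact contMDiffOn_fst.congr fun z hz ↦ fst_baseChange_symm _ _ _ hz
        · refine (he.isPartialDiffeo.contMDiffOn_symm.comp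
            ((hf.comp_contMDiffOn contMDiffOn_fst).prodMk contMDiffOn_snd) fun z hz ↦ hz).congr
            fun z hz ↦ snd_baseChange_symm _ _ _ hz }
  fst_apply _ _ := rfl

theorem isLocallyProduct_fiberProductFst : IsLocallyProduct (fiberProductFst hf hp) c := fun q ↦
  ⟨rfl, _, isProductChart_baseChange hf hp (hp (fiberProductSnd hf hp q)).2.choose_spec.1 q,
    (hp (fiberProductSnd hf hp q)).2.choose_spec.2⟩

/-- The fiber over `x` is the continuous image of `p⁻¹(f x)` under `m ↦ (x, m)`. -/
theorem isConnected_fiberProductFst_fiber (hc : ∀ y, IsConnected (p ⁻¹' {y})) (x : X) :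
    IsConnected (fiberProductFst hf hp ⁻¹' {x}) := by
  have : ConnectedSpace (p ⁻¹' {f x}) := isConnected_iff_connectedSpace.1 (hc (f x))
  let g : p ⁻¹' {f x} → fiberProductMfd hf hp := fun m ↦ ⟨(x, m), m.2.symm⟩
  have hg : Continuous g :=
    (isInducing_prodMk (f := f) (p := p)).continuous_iff.2
      (continuous_const.prodMk continuous_subtype_val)
  convert isConnected_range hg
  ext q
  constructor
  · rintro rfl
    exact ⟨⟨fiberProductSnd hf hp q, q.condition.symm⟩, rfl⟩
  · rintro ⟨m, rfl⟩
    rfl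

theorem fiberProductFst_surjective (hs : Function.Surjective p) :
    Function.Surjective (fiberProductFst hf hp) := fun x ↦ by
  obtain ⟨m, hm⟩ := hs (f x)
  exact ⟨⟨(x, m), hm.symm⟩, rfl⟩

end FiberProductMfd

/-! ### Preimages of weakly-embedded submanifolds. -/

section WeakEmbedding

variable {X Y M N : SmoothMfd.{u}} {ι : X → N} {p : M → N} {c : ℕ} {L : Set N}

theorem IsWeakEmbeddingOnto.contMDiff (h : IsWeakEmbeddingOnto ι L) :
    ContMDiff (𝓡 X.dim) (𝓡 N.dim) ∞ ι :=
  h.isImmersion.contMDiff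

/-- Smooth maps with values in a weakly-embedded submanifold are smooth into the submanifold. -/
theorem IsWeakEmbeddingOnto.exists_lift (h : IsWeakEmbeddingOnto ι L) {g : Y → N}
    (hg : ContMDiff (𝓡 Y.dim) (𝓡 N.dim) ∞ g) (hgL : ∀ y, g y ∈ L) :
    ∃ g' : Y → X, ContMDiff (𝓡 Y.dim) (𝓡 X.dim) ∞ g' ∧ ι ∘ g' = g := by
  have hgr : ∀ y, ∃ x, ι x = g y := fun y ↦ by
    rw [← mem_range, h.range_eq]
    exact hgL y
  choose g' hg' using hgr
  refine ⟨g', fun y ↦ ?_, funext hg'⟩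
  set e := chartAt (EuclideanSpace ℝ (Fin Y.dim)) y
  have he : IsPartialDiffeo (𝓡 Y.dim) (𝓡 Y.dim) e := .chartAt y
  have hy : y ∈ e.source := mem_chart_source _ y
  -- The plot condition only tests maps from open sets of Cartesian spaces, so it is applied in a
  -- chart of `Y`.
  have h₁ : ContMDiffOn (𝓡 Y.dim) (𝓡 X.dim) ∞ (g' ∘ e.symm) e.target := by
    refine (h.plots _ _ e.open_target _).2 ?_
    rw [← Function.comp_assoc, show ι ∘ g' = g from funext hg']
    exact hg.comp_contMDiffOn he.contMDiffOn_symm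
  have h₂ := (h₁.contMDiffAt (e.open_target.mem_nhds (e.map_source hy))).comp y
    (he.contMDiffAt hy)
  exact h₂.congr_of_eventuallyEq <| Filter.eventuallyEq_of_mem (e.open_source.mem_nhds hy)
    fun y' hy' ↦ congrArg g' (e.left_inv hy').symm

variable (hι : IsWeakEmbeddingOnto ι L) (hp : IsLocallyProduct p c)

/-- The chart passes through `M → N × ℝᶜ → (X × ℝᵈ) × ℝᶜ → (X × ℝᶜ) × ℝᵈ`, and the inverse base
change of `e'` turns `X × ℝᶜ` back into the fiber product. -/
theorem isSliceChart_fiberProductSnd {d : ℕ} {O : Set X}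
    {e : OpenPartialHomeomorph N (X × EuclideanSpace ℝ (Fin d))} (he : IsSliceChart ι O e)
    {e' : OpenPartialHomeomorph M (N × EuclideanSpace ℝ (Fin c))} (he' : IsProductChart p e')
    (q : FiberProduct ι p) :
    IsSliceChart (fiberProductSnd hι.contMDiff hp)
      (fiberProductFst hι.contMDiff hp ⁻¹' O ∩ fiberProductSnd hι.contMDiff hp ⁻¹' e'.source)
      ((e'.trans (e.prod (.refl _))).trans ((prodRightComm _ _ _).toOpenPartialHomeomorph.trans
        ((FiberProduct.baseChange hι.contMDiff.continuous he' q).symm.prod (.refl _)))) := by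
  have key : ∀ z ∈ fiberProductFst hι.contMDiff hp ⁻¹' O ∩
      fiberProductSnd hι.contMDiff hp ⁻¹' e'.source,
      ι (fiberProductFst hι.contMDiff hp z) = (e' (fiberProductSnd hι.contMDiff hp z)).1 :=
    fun z hz ↦ (FiberProduct.condition z).trans (he'.fst_apply _ hz.2).symm
  have key' : ∀ z ∈ fiberProductFst hι.contMDiff hp ⁻¹' O ∩
      fiberProductSnd hι.contMDiff hp ⁻¹' e'.source,
      e (e' (fiberProductSnd hι.contMDiff hp z)).1 = (fiberProductFst hι.contMDiff hp z, 0) :=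
    fun z hz ↦ by rw [← key z hz, he.apply_eq _ hz.1]
  refine ⟨(he'.isPartialDiffeo.trans (he.isPartialDiffeo.prod .refl)).trans
    (isPartialDiffeo_prodRightComm.trans
      ((isProductChart_baseChange hι.contMDiff hp he' q).isPartialDiffeo.symm.prod .refl)), ?_,
    fun z hz ↦ ?_, fun z hz ↦ ?_⟩
  · exact (he.isOpen.preimage (contMDiff_fiberProductFst _ _).continuous).inter
      (e'.open_source.preimage (contMDiff_fiberProductSnd _ _).continuous)
  · refine ⟨⟨hz.2, ?_, mem_univ _⟩, mem_univ _, ?_, mem_univ _⟩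
    · change (e' (fiberProductSnd hι.contMDiff hp z)).1 ∈ e.source
      rw [← key z hz]
      exact he.mapsTo hz.1
    · change (ι (e (e' (fiberProductSnd hι.contMDiff hp z)).1).1,
        (e' (fiberProductSnd hι.contMDiff hp z)).2) ∈ e'.target
      rw [key' z hz, key z hz]
      exact e'.map_source hz.2
  · change ((FiberProduct.baseChange hι.contMDiff.continuous he' q).symm
      ((e (e' (fiberProductSnd hι.contMDiff hp z)).1).1,
        (e' (fiberProductSnd hι.contMDiff hp z)).2),
      (e (e' (fiberProductSnd hι.contMDiff hp z)).1).2) = (z, 0)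
    rw [key' z hz]
    exact congrArg (·, 0)
      ((FiberProduct.baseChange hι.contMDiff.continuous he' q).left_inv hz.2)

/-- The preimage of a weakly-embedded submanifold under a submersion is weakly embedded. -/
theorem isWeakEmbeddingOnto_fiberProductSnd (hd : N.dim + c = M.dim) :
    IsWeakEmbeddingOnto (fiberProductSnd hι.contMDiff hp) (p ⁻¹' L) where
  range_eq := by
    ext m
    constructor
    · rintro ⟨q, rfl⟩
      exact hι.range_eq.le ⟨_, FiberProduct.condition q⟩
    · intro hm
      rw [mem_preimage, ← hι.range_eq] at hm
      obtain ⟨x, hx⟩ := hm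
      exact ⟨⟨(x, m), hx⟩, rfl⟩
  injective q q' h := by
    refine FiberProduct.ext (hι.injective ?_) h
    rw [FiberProduct.condition q, FiberProduct.condition q']
    exact congrArg p h
  isImmersion := by
    rcases isEmpty_or_nonempty (fiberProductMfd hι.contMDiff hp) with hE | ⟨⟨q₀⟩⟩
    -- Without a point there is no inequality `X.dim ≤ N.dim` to use, but any complement will do.
    · exact ⟨PUnit, inferInstance, inferInstance, fun q ↦ (hE.false q).elim⟩
    obtain ⟨hd', -⟩ := exists_isSliceChart hι.isImmersion (fiberProductFst hι.contMDiff hp q₀)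
    refine isImmersion_of_isSliceChart (d := N.dim - X.dim) ?_ fun q ↦ ?_
    · change X.dim + c + (N.dim - X.dim) = M.dim
      omega
    · obtain ⟨-, O, e, he, hx⟩ :=
        exists_isSliceChart hι.isImmersion (fiberProductFst hι.contMDiff hp q)
      obtain ⟨-, e', he', hm⟩ := hp (fiberProductSnd hι.contMDiff hp q)
      exact ⟨_, _, isSliceChart_fiberProductSnd hι hp he he' q, hx, hm⟩
  plots n U hU g := by
    refine ⟨(contMDiff_fiberProductSnd hι.contMDiff hp).comp_contMDiffOn, fun h ↦ ?_⟩
    -- The `X`-component becomes `p` of the `M`-component after `ι`, so it is smooth by the plot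
    -- condition of `ι`.
    refine contMDiffOn_fiberProduct hι.contMDiff hp hU ((hι.plots n U hU _).2 ?_) h
    exact (hp.contMDiff.comp_contMDiffOn h).congr fun z _ ↦ FiberProduct.condition (g z)

/-- Connectedness is in the manifold topology: the fiber product maps to the connected `X` by an
open surjection with connected fibers. -/
theorem isConnectedWeaklyEmbedded_preimage {k : ℕ} (hL : IsConnectedWeaklyEmbedded L k)
    (hp : IsLocallyProduct p c) (hd : N.dim + c = M.dim) (hs : Function.Surjective p)
    (hc : ∀ y, IsConnected (p ⁻¹' {y})) : IsConnectedWeaklyEmbedded (p ⁻¹' L) (k + c) := by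
  obtain ⟨X, ι, rfl, hX, hι⟩ := hL
  refine ⟨fiberProductMfd hι.contMDiff hp, _, rfl, ?_,
    isWeakEmbeddingOnto_fiberProductSnd hι hp hd⟩
  rw [connectedSpace_iff_univ, ← preimage_univ (f := fiberProductFst hι.contMDiff hp)]
  exact isConnected_preimage_of_isOpenMap (contMDiff_fiberProductFst _ _).continuous
    (isLocallyProduct_fiberProductFst _ _).isOpenMap (fiberProductFst_surjective _ _ hs)
    (isConnected_fiberProductFst_fiber _ _ hc) isClosed_univ isConnected_univ

end WeakEmbedding

/-! ### Tangent vectors of fiber products. -/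

section Tangent

variable {X M N : SmoothMfd.{u}} {f : X → N} {p : M → N} {c : ℕ}

theorem tangentMap_congr {E E' H H' Y Z : Type*} [NormedAddCommGroup E] [NormedSpace ℝ E]
    [NormedAddCommGroup E'] [NormedSpace ℝ E'] [TopologicalSpace H] [TopologicalSpace H']
    {I : ModelWithCorners ℝ E H} {I' : ModelWithCorners ℝ E' H'} [TopologicalSpace Y]
    [ChartedSpace H Y] [TopologicalSpace Z] [ChartedSpace H' Z] {g g' : Y → Z}
    {v : TangentBundle I Y} (h : g =ᶠ[nhds v.proj] g') :
    tangentMap I I' g v = tangentMap I I' g' v := by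
  refine Bundle.TotalSpace.ext h.eq_of_nhds ?_
  simp only [tangentMap]
  rw [h.mfderiv_eq]
  rfl

/-- By `h` the base component of `u` is `df(w)`, and `d(f × id)` keeps the fiber component. -/
theorem tangentMap_prodMap_id (hf : ContMDiff (𝓡 X.dim) (𝓡 N.dim) ∞ f)
    (w : TangentBundle (𝓡 X.dim) X)
    (u : TangentBundle ((𝓡 N.dim).prod (𝓡 c)) (N × EuclideanSpace ℝ (Fin c)))
    (h : tangentMap (𝓡 X.dim) (𝓡 N.dim) f w =
      tangentMap ((𝓡 N.dim).prod (𝓡 c)) (𝓡 N.dim) Prod.fst u) :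
    tangentMap ((𝓡 X.dim).prod (𝓡 c)) ((𝓡 N.dim).prod (𝓡 c)) (Prod.map f id)
      ⟨(w.proj, u.proj.2), (w.2, u.2.2)⟩ = u := by
  obtain ⟨⟨y, s⟩, ⟨η, σ⟩⟩ := u
  rw [tangentMap_prodFst] at h
  cases h
  refine Bundle.TotalSpace.ext rfl (heq_of_eq ?_)
  simp only [tangentMap]
  rw [mfderiv_prodMap (hf.mdifferentiableAt (by simp)) mdifferentiableAt_id, mfderiv_id]
  rfl

/-- The tangent space of a fiber product is the fiber product of the tangent spaces. -/
theorem exists_tangentMap_fiberProductSnd (hf : ContMDiff (𝓡 X.dim) (𝓡 N.dim) ∞ f)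
    (hp : IsLocallyProduct p c) (v : TangentBundle (𝓡 M.dim) M) (w : TangentBundle (𝓡 X.dim) X)
    (h : tangentMap (𝓡 M.dim) (𝓡 N.dim) p v = tangentMap (𝓡 X.dim) (𝓡 N.dim) f w) :
    ∃ z, tangentMap (𝓡 (fiberProductMfd hf hp).dim) (𝓡 M.dim) (fiberProductSnd hf hp) z = v := by
  obtain ⟨-, e, he, hm⟩ := hp v.proj
  have hxm : f w.proj = p v.proj := (congrArg Bundle.TotalSpace.proj h).symm
  have hes : e v.proj = (f w.proj, (e v.proj).2) :=
    Prod.ext ((he.fst_apply _ hm).trans hxm.symm) rfl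
  let q : FiberProduct f p := ⟨(w.proj, v.proj), hxm⟩
  let b : OpenPartialHomeomorph (fiberProductMfd hf hp) (X × EuclideanSpace ℝ (Fin c)) :=
    FiberProduct.baseChange hf.continuous he q
  have hb : IsPartialDiffeo (𝓡 (fiberProductMfd hf hp).dim) ((𝓡 X.dim).prod (𝓡 c)) b :=
    (isProductChart_baseChange hf hp he q).isPartialDiffeo
  let u := tangentMap (𝓡 M.dim) ((𝓡 N.dim).prod (𝓡 c)) e v
  -- The desired vector in the base-changed chart: `w` along `X`, and the fiber component of `de(v)`
  -- along `ℝᶜ`.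
  let a : TangentBundle ((𝓡 X.dim).prod (𝓡 c)) (X × EuclideanSpace ℝ (Fin c)) :=
    ⟨(w.proj, u.proj.2), (w.2, u.2.2)⟩
  have ha : a.proj ∈ b.target := b.map_source (x := q) hm
  have hev : p =ᶠ[nhds v.proj] Prod.fst ∘ e :=
    Filter.eventuallyEq_of_mem (e.open_source.mem_nhds hm) fun m hm ↦ (he.fst_apply m hm).symm
  have heD : MDifferentiableAt (𝓡 M.dim) ((𝓡 N.dim).prod (𝓡 c)) e v.proj :=
    (he.isPartialDiffeo.contMDiffAt hm).mdifferentiableAt (by simp)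
  have heD' : MDifferentiableAt ((𝓡 N.dim).prod (𝓡 c)) (𝓡 M.dim) e.symm (e v.proj) :=
    (he.isPartialDiffeo.contMDiffAt_symm (e.map_source hm)).mdifferentiableAt (by simp)
  have hfD : MDifferentiableAt ((𝓡 X.dim).prod (𝓡 c)) ((𝓡 N.dim).prod (𝓡 c))
      (Prod.map f id) a.proj :=
    (hf.prodMap contMDiff_id).mdifferentiableAt (by simp)
  have key : tangentMap ((𝓡 X.dim).prod (𝓡 c)) ((𝓡 N.dim).prod (𝓡 c)) (Prod.map f id) a =
      tangentMap (𝓡 M.dim) ((𝓡 N.dim).prod (𝓡 c)) e v := by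
    refine tangentMap_prodMap_id hf w u ?_
    rw [← h, tangentMap_congr hev, tangentMap_comp_at _ mdifferentiableAt_fst heD]
  have hsnd : fiberProductSnd hf hp ∘ b.symm =ᶠ[nhds a.proj] e.symm ∘ Prod.map f id :=
    Filter.eventuallyEq_of_mem (b.open_target.mem_nhds ha) fun z hz ↦
      FiberProduct.snd_baseChange_symm _ _ _ hz
  have hinv : e.symm ∘ e =ᶠ[nhds v.proj] id :=
    Filter.eventuallyEq_of_mem (e.open_source.mem_nhds hm) fun m hm ↦ e.left_inv hm
  have hes' : e v.proj = Prod.map f id a.proj := hes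
  refine ⟨tangentMap _ _ b.symm a, ?_⟩
  -- In the chart the projection is `e.symm ∘ (f × id)`; it sends `a` through `de(v)` back to `v`.
  rw [← tangentMap_comp_at _ ((contMDiff_fiberProductSnd hf hp).mdifferentiableAt (by simp))
    ((hb.contMDiffAt_symm ha).mdifferentiableAt (by simp)), tangentMap_congr hsnd,
    tangentMap_comp_at _ (hes' ▸ heD') hfD, key, ← tangentMap_comp_at _ heD' heD,
    tangentMap_congr hinv, tangentMap_id, id]

end Tangent

/-! ### Adapted charts and the pullback foliation. -/

section AdaptedChart

variable {M N : SmoothMfd.{u}} {p : M → N} {c : ℕ}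

/-- Fibers of `p` lie inside the new leaves, so the fiber coordinates join the leaf directions `ℝᵏ`,
while the transverse factor stays `ℝˡ`. -/
theorem hasAdaptedChart_preimage {leaves : Set (Set N)} {k : ℕ} (hp : IsLocallyProduct p c) (m : M)
    (h : HasAdaptedChart leaves k (p m)) :
    HasAdaptedChart {S | ∃ L ∈ leaves, S = p ⁻¹' L} (k + c) m := by
  obtain ⟨l, hl, ψ, U, W, hψ, hψ', hU, hW, hUW, hmψ, hψm, hleaf⟩ := h
  obtain ⟨hd, e, he, hm⟩ := hp m
  have hψD : IsPartialDiffeo (𝓡 N.dim) ((𝓡 k).prod (𝓡 l)) ψ := by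
    constructor <;> rwa [← modelWithCornersSelf_prod, chartedSpaceSelf_prod]
  -- This translation puts the fiber coordinate of `m` at the origin.
  let τ := Homeomorph.subRight (e m).2
  have hτ : IsPartialDiffeo (𝓡 c) (𝓡 c) τ.toOpenPartialHomeomorph :=
    .ofHomeomorph _ (contMDiff_iff_contDiff.2 (contDiff_id.sub contDiff_const))
      (contMDiff_iff_contDiff.2 (contDiff_id.add contDiff_const))
  let L : (EuclideanSpace ℝ (Fin k) × EuclideanSpace ℝ (Fin c)) ≃L[ℝ]
    EuclideanSpace ℝ (Fin (k + c)) := euclideanSum rfl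
  let Θ := (e.trans (ψ.prod τ.toOpenPartialHomeomorph)).trans
    ((prodRightComm _ _ _).toOpenPartialHomeomorph.trans
      (L.toHomeomorph.toOpenPartialHomeomorph.prod (.refl _)))
  have hΘ : IsPartialDiffeo (𝓡 M.dim) ((𝓡 (k + c)).prod (𝓡 l)) Θ :=
    (he.isPartialDiffeo.trans (hψD.prod hτ)).trans
      (isPartialDiffeo_prodRightComm.trans ((isPartialDiffeo_euclideanSum rfl).prod .refl))
  have hsource : ∀ m' ∈ Θ.source, m' ∈ e.source ∧ p m' ∈ ψ.source := by
    intro m' hm'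
    have h₁ : m' ∈ e.source := hm'.1.1
    have h₂ : (e m').1 ∈ ψ.source := hm'.1.2.1
    exact ⟨h₁, he.fst_apply m' h₁ ▸ h₂⟩
  have hΘe : ∀ m', Θ m' = (L ((ψ (e m').1).1, (e m').2 - (e m).2), (ψ (e m').1).2) := fun _ ↦ rfl
  have hΘsource : m ∈ Θ.source :=
    ⟨⟨hm, (he.fst_apply m hm).symm ▸ hmψ, mem_univ _⟩, mem_univ _, mem_univ _, mem_univ _⟩
  have hΘm : Θ m = (0, 0) := by
    rw [hΘe, he.fst_apply m hm, hψm, sub_self]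
    exact Prod.ext (map_zero L) rfl
  -- The target of `Θ` need not be a product, so it is shrunk to a box about the origin.
  obtain ⟨U', W', hU', hW', h0U, h0W, hsub⟩ := isOpen_prod_iff.1 Θ.open_target 0 0
    (by rw [← hΘm]; exact Θ.map_source hΘsource)
  have hUW' : IsOpen (U' ×ˢ W') := hU'.prod hW'
  let Θ' := (Θ.symm.restrOpen _ hUW').symm
  have hΘ' : IsPartialDiffeo (𝓡 M.dim) ((𝓡 (k + c)).prod (𝓡 l)) Θ' :=
    (hΘ.symm.restrOpen _ hUW').symm
  obtain ⟨hΘ'₁, hΘ'₂⟩ := hΘ'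
  rw [← modelWithCornersSelf_prod, chartedSpaceSelf_prod] at hΘ'₁ hΘ'₂
  have hΘ'source : ∀ m', m' ∈ Θ'.source ↔ m' ∈ Θ.source ∧ Θ m' ∈ U' ×ˢ W' := fun _ ↦ Iff.rfl
  refine ⟨l, by omega, Θ', U', W', hΘ'₁, hΘ'₂, hU', hW',
    inter_eq_right.2 hsub, (hΘ'source m).2 ⟨hΘsource, hΘm ▸ ⟨h0U, h0W⟩⟩, hΘm, ?_⟩
  rintro _ ⟨S, hS, rfl⟩
  obtain ⟨ℓ, hℓ, hψS⟩ := hleaf S hS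
  -- Membership in a leaf depends on the transverse coordinate alone; this survives the shrinking.
  have hmem : ∀ m' ∈ Θ.source, p m' ∈ S ↔ (Θ m').2 ∈ ℓ := by
    intro m' hm'
    obtain ⟨h₁, h₂⟩ := hsource m' hm'
    have h₃ : ψ (p m') ∈ U ×ˢ W := hUW ▸ ψ.map_source h₂
    rw [hΘe, he.fst_apply m' h₁]
    refine ⟨fun h ↦ (hψS.le ⟨p m', ⟨h, h₂⟩, rfl⟩ : ψ (p m') ∈ U ×ˢ ℓ).2, fun h ↦ ?_⟩
    obtain ⟨y, ⟨hy, hy'⟩, hyp⟩ := hψS.ge (⟨h₃.1, h⟩ : ψ (p m') ∈ U ×ˢ ℓ)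
    exact ψ.injOn hy' h₂ hyp ▸ hy
  refine ⟨ℓ ∩ W', inter_subset_right, Subset.antisymm ?_ ?_⟩
  · rintro _ ⟨m', ⟨hm'S, hm'⟩, rfl⟩
    rw [hΘ'source] at hm'
    exact ⟨hm'.2.1, (hmem m' hm'.1).1 hm'S, hm'.2.2⟩
  · rintro z ⟨hz₁, hz₂, hz₃⟩
    have hz : z ∈ Θ.target := hsub ⟨hz₁, hz₃⟩
    have hz' : Θ (Θ.symm z) = z := Θ.right_inv hz
    exact ⟨Θ.symm z, ⟨(hmem _ (Θ.map_target hz)).2 (by rwa [hz']),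
      (hΘ'source _).2 ⟨Θ.map_target hz, by rw [hz']; exact ⟨hz₁, hz₃⟩⟩⟩, hz'⟩

end AdaptedChart

/-- The pullback of a singular foliation along a submersion with connected fibers. -/
def pullbackFoliation {M N : SmoothMfd.{u}} {p : M → N} {c : ℕ} (hp : IsLocallyProduct p c)
    (hs : Function.Surjective p) (hc : ∀ y, IsConnected (p ⁻¹' {y})) (G : SingularFoliation N) :
    SingularFoliation M where
  leaves := {S | ∃ L ∈ G.leaves, S = p ⁻¹' L}
  isPartition := by
    refine ⟨?_, fun m ↦ ?_⟩
    · rintro ⟨L, hL, h⟩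
      obtain ⟨y, hy⟩ := Setoid.nonempty_of_mem_partition G.isPartition hL
      obtain ⟨m, rfl⟩ := hs y
      exact (h ▸ hy : m ∈ (∅ : Set M))
    · obtain ⟨L, ⟨hL, hm⟩, huniq⟩ := G.isPartition.2 (p m)
      refine ⟨p ⁻¹' L, ⟨⟨L, hL, rfl⟩, hm⟩, ?_⟩
      rintro _ ⟨⟨L', hL', rfl⟩, hm'⟩
      rw [huniq L' ⟨hL', hm'⟩]
  isLeaf := by
    rintro _ ⟨L, hL, rfl⟩
    obtain ⟨k, hk, hchart⟩ := G.isLeaf L hL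
    -- A point over the leaf is needed because `IsLocallyProduct` gives its dimension identity
    -- pointwise.
    obtain ⟨y, hy⟩ := Setoid.nonempty_of_mem_partition G.isPartition hL
    obtain ⟨m, rfl⟩ := hs y
    exact ⟨k + c, isConnectedWeaklyEmbedded_preimage hk hp (hp m).1 hs hc,
      fun m hm ↦ hasAdaptedChart_preimage hp m (hchart (p m) hm)⟩

/-- If `κ` parametrizes `p⁻¹(L)`, then `p ∘ κ` lifts smoothly through a parametrization of `L`, so
`dp` maps its tangent vectors into those of `L`. Conversely, a vector whose image is tangent to `L`
comes from the fiber product. -/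
theorem isPullback_pullbackFoliation {M N : SmoothMfd.{u}} {p : M → N} {c : ℕ}
    (hp : IsLocallyProduct p c) (hs : Function.Surjective p) (hc : ∀ y, IsConnected (p ⁻¹' {y}))
    (G : SingularFoliation N) : IsPullback p G (pullbackFoliation hp hs hc G) where
  leaves_eq := rfl
  tangentDistribution_eq := by
    ext v
    constructor
    · rintro ⟨_, ⟨L, hL, rfl⟩, Y, κ, hκ, w, rfl⟩
      obtain ⟨k, ⟨X, ι, -, -, hι⟩, -⟩ := G.isLeaf L hL
      obtain ⟨g, hg, hgκ⟩ := hι.exists_lift (hp.contMDiff.comp hκ.contMDiff) fun y ↦ by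
        have : κ y ∈ p ⁻¹' L := hκ.range_eq ▸ mem_range_self y
        exact this
      refine ⟨L, hL, X, ι, hι, tangentMap _ _ g w, ?_⟩
      rw [← Function.comp_apply (f := tangentMap _ _ ι), ← Function.comp_apply (f := tangentMap _ _ p),
        ← tangentMap_comp (hι.contMDiff.mdifferentiable (by simp)) (hg.mdifferentiable (by simp)),
        ← tangentMap_comp (hp.contMDiff.mdifferentiable (by simp))
          (hκ.contMDiff.mdifferentiable (by simp)), hgκ]
    · rintro ⟨L, hL, X, ι, hι, w, hw⟩
      obtain ⟨z, hz⟩ := exists_tangentMap_fiberProductSnd hι.contMDiff hp v w hw.symm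
      exact ⟨p ⁻¹' L, ⟨L, hL, rfl⟩, _, _,
        isWeakEmbeddingOnto_fiberProductSnd hι hp (hp v.proj).1, z, hz⟩

section Pullback

variable {P M N : SmoothMfd.{u}} {r : P → M} {p : M → N}
  {F : SingularFoliation P} {G : SingularFoliation M} {H : SingularFoliation N}

theorem preimage_tangentMap_comp (hr : ContMDiff (𝓡 P.dim) (𝓡 M.dim) ∞ r)
    (hp : ContMDiff (𝓡 M.dim) (𝓡 N.dim) ∞ p) (S : Set (TangentBundle (𝓡 N.dim) N)) :
    tangentMap (𝓡 P.dim) (𝓡 N.dim) (p ∘ r) ⁻¹' S =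
      tangentMap (𝓡 P.dim) (𝓡 M.dim) r ⁻¹' (tangentMap (𝓡 M.dim) (𝓡 N.dim) p ⁻¹' S) := by
  rw [tangentMap_comp (hp.mdifferentiable (by simp)) (hr.mdifferentiable (by simp)),
    preimage_comp]

/-- Pullback along `r` of a pullback along `p` is the same as pullback along `p ∘ r`. -/
theorem IsPullback.iff_comp (hG : IsPullback p H G) (hr : ContMDiff (𝓡 P.dim) (𝓡 M.dim) ∞ r)
    (hp : ContMDiff (𝓡 M.dim) (𝓡 N.dim) ∞ p) :
    IsPullback r G F ↔ IsPullback (p ∘ r) H F := by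
  have hleaves : {S | ∃ L ∈ G.leaves, S = r ⁻¹' L} = {S | ∃ L ∈ H.leaves, S = p ∘ r ⁻¹' L} := by
    rw [hG.leaves_eq]
    ext S
    constructor
    · rintro ⟨_, ⟨L, hL, rfl⟩, rfl⟩
      exact ⟨L, hL, rfl⟩
    · rintro ⟨L, hL, rfl⟩
      exact ⟨_, ⟨L, hL, rfl⟩, rfl⟩
  constructor
  · intro h
    refine ⟨?_, h.leaves_eq.trans hleaves⟩
    rw [h.tangentDistribution_eq, hG.tangentDistribution_eq, preimage_tangentMap_comp hr hp]
  · intro h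
    refine ⟨?_, h.leaves_eq.trans hleaves.symm⟩
    rw [h.tangentDistribution_eq, hG.tangentDistribution_eq, preimage_tangentMap_comp hr hp]

theorem IsPullback.refl (F : SingularFoliation M) : IsPullback id F F where
  tangentDistribution_eq := by rw [tangentMap_id, preimage_id]
  leaves_eq := by simp

end Pullback

/-! ### Composition and base change of submersions with connected fibers. -/

section Submersion

variable {P M N : SmoothMfd.{u}} {r : P → M} {p : M → N}

theorem IsConnectedFiberSubmersion.isLocallyProduct (h : IsConnectedFiberSubmersion p) :
    IsLocallyProduct p (M.dim - N.dim) :=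
  .of_isSubmersion h.isSubmersion

theorem IsConnectedFiberSubmersion.contMDiff (h : IsConnectedFiberSubmersion p) :
    ContMDiff (𝓡 M.dim) (𝓡 N.dim) ∞ p :=
  h.isSubmersion.contMDiff

theorem IsConnectedFiberSubmersion.refl : IsConnectedFiberSubmersion (id : M → M) where
  surjective := Function.surjective_id
  isSubmersion := .id
  isConnected_fiber _ := isConnected_singleton

theorem IsConnectedFiberSubmersion.comp (hp : IsConnectedFiberSubmersion p)
    (hr : IsConnectedFiberSubmersion r) : IsConnectedFiberSubmersion (p ∘ r) where
  surjective := hp.surjective.comp hr.surjective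
  isSubmersion := (hr.isLocallyProduct.comp hp.isLocallyProduct).isSubmersion
  isConnected_fiber y := isConnected_preimage_of_isOpenMap hr.contMDiff.continuous
    hr.isLocallyProduct.isOpenMap hr.surjective hr.isConnected_fiber
    (isClosed_singleton.preimage hp.contMDiff.continuous) (hp.isConnected_fiber y)

theorem IsConnectedFiberSubmersion.fiberProductFst {X : SmoothMfd.{u}} {f : X → N} {c : ℕ}
    (hf : ContMDiff (𝓡 X.dim) (𝓡 N.dim) ∞ f) (hp : IsConnectedFiberSubmersion p)
    (hc : IsLocallyProduct p c) : IsConnectedFiberSubmersion (fiberProductFst hf hc) where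
  surjective := fiberProductFst_surjective hf hc hp.surjective
  isSubmersion := (isLocallyProduct_fiberProductFst hf hc).isSubmersion
  isConnected_fiber := isConnected_fiberProductFst_fiber hf hc hp.isConnected_fiber

end Submersion

section Swap

variable {X M N : SmoothMfd.{u}} {f : X → N} {p : M → N} {b c : ℕ}

/-- The exchange of the factors of a fiber product of two submersions. -/
def fiberProductSwap (hf : IsLocallyProduct f b) (hp : IsLocallyProduct p c) :
    fiberProductMfd hf.contMDiff hp ≃ₜ fiberProductMfd hp.contMDiff hf where
  toFun q := ⟨(q.snd, q.fst), q.condition.symm⟩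
  invFun q := ⟨(q.snd, q.fst), q.condition.symm⟩
  left_inv _ := rfl
  right_inv _ := rfl
  continuous_toFun := FiberProduct.isInducing_prodMk.continuous_iff.2
    (FiberProduct.continuous_snd.prodMk FiberProduct.continuous_fst)
  continuous_invFun := FiberProduct.isInducing_prodMk.continuous_iff.2
    (FiberProduct.continuous_snd.prodMk FiberProduct.continuous_fst)

theorem contMDiff_fiberProductSwap (hf : IsLocallyProduct f b) (hp : IsLocallyProduct p c) :
    ContMDiff (𝓡 (fiberProductMfd hf.contMDiff hp).dim) (𝓡 (fiberProductMfd hp.contMDiff hf).dim)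
      ∞ (fiberProductSwap hf hp) :=
  contMDiffOn_univ.1 <| contMDiffOn_fiberProduct hp.contMDiff hf isOpen_univ
    (contMDiff_fiberProductSnd hf.contMDiff hp).contMDiffOn
    (contMDiff_fiberProductFst hf.contMDiff hp).contMDiffOn

/-- The swap diffeomorphism transports the product charts of the first projection of the exchanged
fiber product. -/
theorem isLocallyProduct_fiberProductSnd (hf : IsLocallyProduct f b) (hp : IsLocallyProduct p c) :
    IsLocallyProduct (fiberProductSnd hf.contMDiff hp) b := fun q ↦ by
  obtain ⟨-, e, he, hq⟩ :=
    isLocallyProduct_fiberProductFst hp.contMDiff hf (fiberProductSwap hf hp q)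
  have hσ : IsPartialDiffeo (𝓡 (fiberProductMfd hf.contMDiff hp).dim)
      (𝓡 (fiberProductMfd hp.contMDiff hf).dim) (fiberProductSwap hf hp).toOpenPartialHomeomorph :=
    .ofHomeomorph _ (contMDiff_fiberProductSwap hf hp) (contMDiff_fiberProductSwap hp hf)
  refine ⟨?_, _, ⟨hσ.trans he.isPartialDiffeo, fun q' hq' ↦ he.fst_apply _ hq'.2⟩,
    mem_univ _, hq⟩
  change M.dim + b = X.dim + c
  have h₁ := (hf q.fst).1
  have h₂ := (hp q.snd).1
  omega

theorem IsConnectedFiberSubmersion.fiberProductSnd (hf : IsConnectedFiberSubmersion f)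
    (hf' : IsLocallyProduct f b) (hp : IsLocallyProduct p c) :
    IsConnectedFiberSubmersion (fiberProductSnd hf'.contMDiff hp) where
  surjective := (fiberProductFst_surjective hp.contMDiff hf' hf.surjective).comp
    (fiberProductSwap hf' hp).surjective
  isSubmersion := (isLocallyProduct_fiberProductSnd hf' hp).isSubmersion
  isConnected_fiber m := (fiberProductSwap hf' hp).isConnected_preimage.2
    (isConnected_fiberProductFst_fiber hp.contMDiff hf' hf.isConnected_fiber m)

end Swap

/-! ### The equivalence relation. -/

theorem MolinoTransverseEquivalent.refl (A : FoliatedMfd.{u}) : MolinoTransverseEquivalent A A :=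
  ⟨A, id, id, .refl, .refl, .refl _, .refl _⟩

theorem MolinoTransverseEquivalent.symm {A B : FoliatedMfd.{u}}
    (h : MolinoTransverseEquivalent A B) : MolinoTransverseEquivalent B A :=
  let ⟨M, p, q, hp, hq, hpF, hqF⟩ := h
  ⟨M, q, p, hq, hp, hqF, hpF⟩

theorem MolinoTransverseEquivalent.trans {A B C : FoliatedMfd.{u}}
    (h : MolinoTransverseEquivalent A B) (h' : MolinoTransverseEquivalent B C) :
    MolinoTransverseEquivalent A C := by
  obtain ⟨M, p, q, hp, hq, hpF, hqF⟩ := h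
  obtain ⟨M', p', q', hp', hq', hpF', hqF'⟩ := h'
  have hqc := hq.isLocallyProduct
  have hpc := hp'.isLocallyProduct
  have h₁ := hp'.fiberProductFst hqc.contMDiff hpc
  have h₂ := hq.fiberProductSnd hqc hpc
  have hF := isPullback_pullbackFoliation h₁.isLocallyProduct h₁.surjective h₁.isConnected_fiber
    M.foliation
  have hcomp : q ∘ fiberProductFst hqc.contMDiff hpc = p' ∘ fiberProductSnd hqc.contMDiff hpc :=
    funext FiberProduct.condition
  -- Descend to `B` along the left side of the square, in order to climb to `M'` along the right
  -- side with the converse direction of `iff_comp`.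
  have hF' := (hqF.iff_comp h₁.contMDiff hq.contMDiff).1 hF
  rw [hcomp] at hF'
  exact ⟨⟨_, _⟩, _, _, hp.comp h₁, hq'.comp h₂,
    (hpF.iff_comp h₁.contMDiff hp.contMDiff).1 hF,
    (hqF'.iff_comp h₂.contMDiff hq'.contMDiff).1
      ((hpF'.iff_comp h₂.contMDiff hp'.contMDiff).2 hF')⟩

end SingularFol

theorem proposition5 :
    Equivalence
      (SingularFol.MolinoTransverseEquivalent.{u} :
        SingularFol.FoliatedMfd.{u} → SingularFol.FoliatedMfd.{u} → Prop) :=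
  ⟨.refl, .symm, .trans⟩
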